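/- Let $M$ be a smooth manifold with a smooth affine metric, that is, a smooth choice on every $T_pM$ of a symmetric function $(x,y)$, affine in each argument, whose bilinear part $\langle x,y\rangle$ is nondegenerate. Assume that $(x,y)=1+\langle x-\mathbf A,\,y-\mathbf A\rangle$ for a smooth vector field $\mathbf A$ on $M$. Let $\nabla$ be the Levi-Civita connection of the semi-Riemannian metric $\langle\cdot,\cdot\rangle$, and let $F$ be the antisymmetric part of $\nabla\mathbf A$: $\langle F(X),Y\rangle=\tfrac12\big(\langle\nabla_X\mathbf A,Y\rangle-\langle X,\nabla_Y\mathbf A\rangle\big)$. Let $\widehat{TM}$ be the vector bundle whose fibre at $p$ is the space of affine functions $T_pM\to\mathbb R$. For $x\in T_pM$ let $\bar x\in\widehat{T_pM}$ be the function $\bar x(y)=(x,y)-(0,y)$, and let $\xi$ be the constant function $1$; every section of $\widehat{TM}$ is uniquely $\bar X+f\xi$ with a vector field $X$ and a function $f$. Equip $\widehat{TM}$ with the anchor $\rho(\bar X+f\xi)=X$, the metric $\langle\bar X+f\xi,\bar Y+g\xi\rangle=\langle X,Y\rangle+fg$, and the Lie algebroid bracket determined by $[\bar X,\bar Y]=\overline{[X,Y]}+2\langle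 F(X),Y\rangle\xi$, $[\bar X,\xi]=0$ and the Leibniz rule. Let $\hat\nabla$ be its Levi-Civita connection: for all sections $U,V,W$ of $\widehat{TM}$, $$2\langle\hat\nabla_UV,W\rangle=\rho(U)\langle V,W\rangle+\rho(V)\langle W,U\rangle-\rho(W)\langle U,V\rangle+\langle[U,V],W\rangle-\langle[V,W],U\rangle+\langle[W,U],V\rangle .$$ Let $J\subseteq\mathbb R$ be an interval with more than one point. A smooth path $\hat\alpha:J\to\widehat{TM}$ is called a geodesic of $\hat\nabla$ if $\rho(\hat\alpha)=\alpha'$ for some smooth path $\alpha:J\to M$, and $\hat\nabla_{\hat\alpha}\hat\alpha=0$ (covariant derivative along the path). **Proposition 3.5.** A smooth path $\hat\alpha:J\to\widehat{TM}$ is a geodesic of $\hat\nabla$ if and only if there are a smooth path $\alpha:J\to M$ and a constant $\lambda\in\mathbb R$ such that $\hat\alpha(t)=\overline{\alpha'(t)}+\lambda\xi$ for all $t\in J$ and $\nabla_{\alpha'}\alpha'=2\lambda F(\alpha')$ on $J$. -/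

import Mathlib

open Set Filter Topology Bundle
open scoped Manifold ContDiff

noncomputable section

/-! ### Affine inner products on a vector space -/

section Algebra

variable {V : Type*} [AddCommGroup V] [Module ℝ V]

/-- The bilinear part `<u,v>` of a 2-affine function `S` on `V`. A function `V × V → ℝ` that is affine
in each argument is written in curried form, as an affine map from `V` to affine functions on `V`. -/
def bilinearPart (S : V →ᵃ[ℝ] (V →ᵃ[ℝ] ℝ)) : LinearMap.BilinForm ℝ V where
  toFun u := (S.linear u).linear
  map_add' u v := by simp
  map_smul' c u := by simp

variable (V) in
/-- An affine inner product: a symmetric 2-affine function `(a,b)` whose bilinear part is an inner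
product, that is, nondegenerate (symmetry is inherited; no definiteness is required). -/
structure AffineInnerProduct where
  /-- the value `(a,b)` is `toAffine a b` -/
  toAffine : V →ᵃ[ℝ] (V →ᵃ[ℝ] ℝ)
  symm : ∀ a b, toAffine a b = toAffine b a
  nondegenerate : (bilinearPart toAffine).Nondegenerate

namespace AffineInnerProduct

variable (S : AffineInnerProduct V)

/-- The inner product `<u,v>`, the bilinear part of `(a,b)`. -/
def inner (u v : V) : ℝ := bilinearPart S.toAffine u v

/-- `x ↦ x̄`, where `x̄` is the affine function `y ↦ <x,y)`, and `<x,y) = (x,y) - (0,y)` is the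
linear-affine part of `(a,b)`. -/
def bar : V →ₗ[ℝ] (V →ᵃ[ℝ] ℝ) := S.toAffine.linear

/-- `ξ`, the constant function `1`. -/
def xi (V : Type*) [AddCommGroup V] [Module ℝ V] : V →ᵃ[ℝ] ℝ := AffineMap.const ℝ V 1

variable [FiniteDimensional ℝ V]

/-- The projection `ρ` from affine functions on `V` to `V`: it kills constants and sends `x̄` to `x`.
As `<x,·>` is the linear part of `x̄`, it is the metric dual of the linear part. -/
def rho (φ : V →ᵃ[ℝ] ℝ) : V :=
  (LinearMap.BilinForm.toDual (bilinearPart S.toAffine) S.nondegenerate).symm φ.linear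

/-- The coefficient of `ξ` in the decomposition `φ = x̄ + c ξ`. -/
def xiCoord (φ : V →ᵃ[ℝ] ℝ) : ℝ := (φ - S.bar (S.rho φ)) 0

theorem rho_bar_add_smul_xi (x : V) (c : ℝ) : S.rho (S.bar x + c • xi V) = x := by
  have h : (S.bar x + c • xi V).linear =
      LinearMap.BilinForm.toDual (bilinearPart S.toAffine) S.nondegenerate x := by
    ext v
    simp [LinearMap.BilinForm.toDual_def, xi, bar, bilinearPart]
  rw [rho, h, LinearEquiv.symm_apply_apply]

theorem xiCoord_bar_add_smul_xi (x : V) (c : ℝ) : S.xiCoord (S.bar x + c • xi V) = c := by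
  rw [xiCoord, rho_bar_add_smul_xi]
  simp [xi]

theorem bar_rho_add_xiCoord (φ : V →ᵃ[ℝ] ℝ) : S.bar (S.rho φ) + S.xiCoord φ • xi V = φ := by
  have h : (S.bar (S.rho φ)).linear = φ.linear := by
    have := (LinearMap.BilinForm.toDual (bilinearPart S.toAffine) S.nondegenerate).apply_symm_apply
      φ.linear
    rw [← this]
    rfl
  ext v
  have h₁ := congrFun (AffineMap.decomp φ) v
  have h₂ := congrFun (AffineMap.decomp (S.bar (S.rho φ))) v
  rw [h] at h₂
  simp only [Pi.add_apply] at h₁ h₂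
  simp only [AffineMap.coe_add, Pi.add_apply, AffineMap.coe_smul, Pi.smul_apply, h₁, h₂, xiCoord,
    xi, AffineMap.coe_sub, Pi.sub_apply, AffineMap.const_apply, smul_eq_mul]
  ring

/-- The inner product `<x̄ + f ξ, ȳ + g ξ> = <x,y> + f g` on affine functions. -/
def hatInner (φ ψ : V →ᵃ[ℝ] ℝ) : ℝ :=
  S.inner (S.rho φ) (S.rho ψ) + S.xiCoord φ * S.xiCoord ψ

end AffineInnerProduct

end Algebra

/-! ### Levi-Civita connections

`M` is a smooth manifold modelled on the finite-dimensional space `E`. A bundle over `M` is given by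
its fibres `V p`, and a section of it is a function `Π p, V p` without any regularity; the smooth
sections are singled out by a predicate `smoothAt σ p` ("`σ` is smooth at `p`"). The definitions of
this part are applied to `TM` and to the bundle of affine functions on the tangent spaces. -/

section Connection

variable {E : Type*} [NormedAddCommGroup E] [NormedSpace ℝ E]
  {M : Type*} [TopologicalSpace M] [ChartedSpace E M]

instance instFiniteDimensionalTangentSpace [FiniteDimensional ℝ E] (p : M) :
    FiniteDimensional ℝ (TangentSpace 𝓘(ℝ, E) p) :=
  inferInstanceAs (FiniteDimensional ℝ E)

/-- The vector field `X` is smooth at `p`. -/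
def SmoothFieldAt [IsManifold 𝓘(ℝ, E) ∞ M] (X : Π p : M, TangentSpace 𝓘(ℝ, E) p) (p : M) : Prop :=
  ContMDiffAt 𝓘(ℝ, E) 𝓘(ℝ, E).tangent ∞ (fun q => (⟨q, X q⟩ : TangentBundle 𝓘(ℝ, E) M)) p

/-- The real function `h` is smooth at `p`. -/
def SmoothFunAt (E : Type*) [NormedAddCommGroup E] [NormedSpace ℝ E]
    {M : Type*} [TopologicalSpace M] [ChartedSpace E M] (h : M → ℝ) (p : M) : Prop :=
  ContMDiffAt 𝓘(ℝ, E) 𝓘(ℝ, ℝ) ∞ h p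

/-- The derivative `v(h)` of the real function `h` in the direction of the tangent vector `v`. -/
def dirDeriv (h : M → ℝ) (p : M) (v : TangentSpace 𝓘(ℝ, E) p) : ℝ :=
  mvfderiv 𝓘(ℝ, E) h p v

variable {V : M → Type*}

/-- The Koszul expression of the sections `U, W, Z` at `p`, for a bundle with anchor `ρ` (a map to `TM`),
bracket `br` of sections and fibre metric `g`:
`ρ(U)<W,Z> + ρ(W)<Z,U> - ρ(Z)<U,W> + <[U,W],Z> - <[W,Z],U> + <[Z,U],W>`. -/
def koszul (ρ : ∀ p, V p → TangentSpace 𝓘(ℝ, E) p)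
    (br : (Π p, V p) → (Π p, V p) → Π p, V p) (g : ∀ p, V p → V p → ℝ)
    (U W Z : Π p, V p) (p : M) : ℝ :=
  dirDeriv (fun q => g q (W q) (Z q)) p (ρ p (U p))
    + dirDeriv (fun q => g q (Z q) (U q)) p (ρ p (W p))
    - dirDeriv (fun q => g q (U q) (W q)) p (ρ p (Z p))
    + g p (br U W p) (Z p) - g p (br W Z p) (U p) + g p (br Z U p) (W p)

/-- The Levi-Civita connection: for a section `W` smooth at `p` and `u` in the fibre over `p`,
`leviCivita smoothAt ρ br g W p u` is `∇_u W`, the unique `w` in the fibre over `p` with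
`2 <∇_U W, Z> = koszul U W Z` at `p` for all `U`, `Z` smooth at `p` with `U p = u`. -/
def leviCivita [∀ p, Zero (V p)] (smoothAt : (Π p, V p) → M → Prop)
    (ρ : ∀ p, V p → TangentSpace 𝓘(ℝ, E) p)
    (br : (Π p, V p) → (Π p, V p) → Π p, V p) (g : ∀ p, V p → V p → ℝ)
    (W : Π p, V p) (p : M) (u : V p) : V p :=
  haveI : Nonempty (V p) := ⟨0⟩
  Classical.epsilon fun w => ∀ U Z : Π p, V p, smoothAt U p → smoothAt Z p → U p = u →
    2 * g p w (Z p) = koszul ρ br g U W Z p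

/-- `HasCovDerivAlong smoothAt nabla J γ a s t w`: at the time `t` in the interval `J`, the section `s`
along the path `γ` has the covariant derivative `w` in the direction of `a`, a section along `γ`
(whose anchor is to be the velocity of `γ`). That is: near `t` in `J` one can write
`s = ∑ i, f i • (σ i ∘ γ)` with functions `f i` on `J` and sections `σ i`, smooth at `t` and at `γ t`,
and `w = ∑ i, (f i)' • σ i + f i • ∇_a (σ i)` at `t`. By the Leibniz rule the value does not depend
on the way of writing `s`; a local frame gives one. -/
def HasCovDerivAlong [∀ p, AddCommGroup (V p)] [∀ p, Module ℝ (V p)]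
    (smoothAt : (Π p, V p) → M → Prop) (nabla : (Π p, V p) → ∀ p, V p → V p)
    (J : Set ℝ) (γ : ℝ → M) (a s : ∀ t, V (γ t)) (t : ℝ) (w : V (γ t)) : Prop :=
  ∃ (n : ℕ) (f : Fin n → ℝ → ℝ) (σ : Fin n → Π p, V p),
    (∀ i, ContDiffWithinAt ℝ ∞ (f i) J t) ∧
    (∀ i, smoothAt (σ i) (γ t)) ∧
    (∀ᶠ r in 𝓝[J] t, s r = ∑ i, f i r • σ i (γ r)) ∧
    w = ∑ i, (derivWithin (f i) J t • σ i (γ t) + f i t • nabla (σ i) (γ t) (a t))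

/-- The velocity `α'(t)` of a path defined on the interval `J` (one-sided at an end point in `J`). -/
def velocity (J : Set ℝ) (α : ℝ → M) (t : ℝ) : TangentSpace 𝓘(ℝ, E) (α t) :=
  mfderivWithin 𝓘(ℝ, ℝ) 𝓘(ℝ, E) α J t (1 : ℝ)

end Connection

/-! ### Affine metrics on a manifold, and the algebroid of affine functions -/

/-- An affine metric on `M`: a smooth choice of an affine inner product on every tangent space. -/
structure AffineMetric (E : Type*) [NormedAddCommGroup E] [NormedSpace ℝ E]
    (M : Type*) [TopologicalSpace M] [ChartedSpace E M] [IsManifold 𝓘(ℝ, E) ∞ M] where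
  /-- the affine inner product on `T_pM` -/
  fiber : ∀ p : M, AffineInnerProduct (TangentSpace 𝓘(ℝ, E) p)
  smooth : ∀ (X Y : Π p : M, TangentSpace 𝓘(ℝ, E) p) (p : M),
    SmoothFieldAt X p → SmoothFieldAt Y p →
    SmoothFunAt E (fun q => (fiber q).toAffine (X q) (Y q)) p

/-- The fibre over `p` of the bundle `T̂M`: the affine functions on `T_pM`. -/
abbrev HatTangent (E : Type*) [NormedAddCommGroup E] [NormedSpace ℝ E]
    {M : Type*} [TopologicalSpace M] [ChartedSpace E M] (p : M) : Type _ :=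
  TangentSpace 𝓘(ℝ, E) p →ᵃ[ℝ] ℝ

/-- The total space of the bundle `T̂M`. -/
abbrev HatBundle (E : Type*) [NormedAddCommGroup E] [NormedSpace ℝ E]
    (M : Type*) [TopologicalSpace M] [ChartedSpace E M] : Type _ :=
  TotalSpace (E →ᵃ[ℝ] ℝ) (HatTangent E : M → Type _)

namespace AffineMetric

variable {E : Type*} [NormedAddCommGroup E] [NormedSpace ℝ E]
  {M : Type*} [TopologicalSpace M] [ChartedSpace E M]
  [IsManifold 𝓘(ℝ, E) ∞ M] (S : AffineMetric E M)

/-- The value `(x,y)` of the affine metric on tangent vectors at `p`. -/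
def aff (p : M) (x y : TangentSpace 𝓘(ℝ, E) p) : ℝ := (S.fiber p).toAffine x y

/-- The associated semi-Riemannian metric `<x,y>`, the bilinear part of `(x,y)`. -/
def metric (p : M) (x y : TangentSpace 𝓘(ℝ, E) p) : ℝ := (S.fiber p).inner x y

/-- The Levi-Civita connection of the associated semi-Riemannian metric;
`S.nabla Y p v` is `∇_v Y`. -/
def nabla : (Π p : M, TangentSpace 𝓘(ℝ, E) p) → ∀ p : M,
    TangentSpace 𝓘(ℝ, E) p → TangentSpace 𝓘(ℝ, E) p :=
  leviCivita SmoothFieldAt (fun _ v => v) (VectorField.mlieBracket 𝓘(ℝ, E)) S.metric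

/-- The antisymmetric part `F` of `∇A`: `F(v)` is the unique vector with
`<F(v),w> = (<∇_v A, w> - <v, ∇_w A>) / 2` for all `w`. -/
def F (A : Π p : M, TangentSpace 𝓘(ℝ, E) p) (p : M) (v : TangentSpace 𝓘(ℝ, E) p) :
    TangentSpace 𝓘(ℝ, E) p :=
  Classical.epsilon fun u => ∀ w : TangentSpace 𝓘(ℝ, E) p,
    S.metric p u w = (1 / 2) * (S.metric p (S.nabla A p v) w - S.metric p v (S.nabla A p w))

/-- The section `ξ` of `T̂M`, the constant function `1` on every tangent space. -/
def xi (p : M) : HatTangent E p := AffineInnerProduct.xi (TangentSpace 𝓘(ℝ, E) p)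

/-- The map `x ↦ x̄` from `TM` to `T̂M`, with `x̄(y) = <x,y)`. -/
def bar (p : M) : TangentSpace 𝓘(ℝ, E) p →ₗ[ℝ] HatTangent E p := (S.fiber p).bar

variable [FiniteDimensional ℝ E]

/-- The anchor `ρ : T̂M → TM`, `x̄ + f ξ ↦ x`. -/
def rho (p : M) (φ : HatTangent E p) : TangentSpace 𝓘(ℝ, E) p := (S.fiber p).rho φ

/-- The `ξ`-component `x̄ + f ξ ↦ f`. -/
def xiCoord (p : M) (φ : HatTangent E p) : ℝ := (S.fiber p).xiCoord φ

/-- The metric `<x̄ + f ξ, ȳ + g ξ> = <x,y> + f g` of `T̂M`. -/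
def hatMetric (p : M) (φ ψ : HatTangent E p) : ℝ := (S.fiber p).hatInner φ ψ

/-- A section of `T̂M` is smooth at `p` if it is `X̄ + f ξ` with `X` and `f` smooth at `p`. -/
def HatSmoothAt (σ : Π p : M, HatTangent E p) (p : M) : Prop :=
  SmoothFieldAt (fun q => S.rho q (σ q)) p ∧ SmoothFunAt E (fun q => S.xiCoord q (σ q)) p

/-- The bracket of sections of `T̂M`. It is determined by `[X̄,Ȳ] = bar [X,Y] + 2 <F(X),Y> ξ`,
`[X̄,ξ] = 0` and the Leibniz rule `[U, f W] = f [U,W] + ρ(U)(f) W`, so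
`[X̄ + f ξ, Ȳ + g ξ] = bar [X,Y] + (2 <F(X),Y> + X(g) - Y(f)) ξ`. -/
def hatBracket (A : Π p : M, TangentSpace 𝓘(ℝ, E) p) (U W : Π p : M, HatTangent E p) (p : M) :
    HatTangent E p :=
  S.bar p (VectorField.mlieBracket 𝓘(ℝ, E)
      (fun q => S.rho q (U q)) (fun q => S.rho q (W q)) p)
    + (2 * S.metric p (S.F A p (S.rho p (U p))) (S.rho p (W p))
      + dirDeriv (fun q => S.xiCoord q (W q)) p (S.rho p (U p))
      - dirDeriv (fun q => S.xiCoord q (U q)) p (S.rho p (W p))) • xi p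

/-- The Levi-Civita connection `∇̂` of the algebroid `T̂M`; `S.hatNabla A W p u` is `∇̂_u W`. -/
def hatNabla (A : Π p : M, TangentSpace 𝓘(ℝ, E) p) :
    (Π p : M, HatTangent E p) → ∀ p : M, HatTangent E p → HatTangent E p :=
  leviCivita S.HatSmoothAt S.rho (S.hatBracket A) S.hatMetric

/-- `a : J → T̂M` is a smooth path: writing `a(t) = v̄(t) + f(t) ξ`, both the path `v` in `TM` and the
function `f` are smooth on the interval `J`. (In particular the base path is smooth.) -/
def IsHatPath (J : Set ℝ) (a : ℝ → HatBundle E M) : Prop :=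
  ContMDiffOn 𝓘(ℝ, ℝ) 𝓘(ℝ, E).tangent ∞
      (fun t => (⟨(a t).proj, S.rho _ (a t).snd⟩ : TangentBundle 𝓘(ℝ, E) M)) J ∧
    ContDiffOn ℝ ∞ (fun t => S.xiCoord _ (a t).snd) J

/-- The path `a : J → T̂M` is a geodesic of `∇̂`: for some path `α : J → M` we have `ρ(a) = α'`, and
`∇̂_a a = 0`. -/
def IsGeodesic (A : Π p : M, TangentSpace 𝓘(ℝ, E) p) (J : Set ℝ) (a : ℝ → HatBundle E M) : Prop :=
  (∃ α : ℝ → M, ContMDiffOn 𝓘(ℝ, ℝ) 𝓘(ℝ, E) ∞ α J ∧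
    ∀ t ∈ J, (⟨(a t).proj, S.rho _ (a t).snd⟩ : TangentBundle 𝓘(ℝ, E) M) =
      ⟨α t, velocity J α t⟩) ∧
  ∀ t ∈ J, HasCovDerivAlong S.HatSmoothAt (S.hatNabla A) J (fun r => (a r).proj)
    (fun r => (a r).snd) (fun r => (a r).snd) t 0

end AffineMetric

end

/-!
The algebroid connection has a closed form in terms of `∇` and `F`: comparing the Koszul expressions
of the algebroid and of the metric, with `F` antisymmetric, gives (`AffineMetric.hatNabla_eq`)

`∇̂_{X̄ + fξ} (Ȳ + gξ) = bar (∇_X Y - f F(Y) - g F(X)) + (X(g) + <F(X),Y>) ξ`.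

Along a path `a = bar α' + f ξ` this becomes `∇̂_a a = bar (∇_{α'} α' - 2 f F(α')) + f' ξ`, since
`<F(α'),α'> = 0`. So `∇̂_a a = 0` says that `f` is constant on the interval and that
`∇_{α'} α' = 2 f F(α')`. A covariant derivative along a path is given by an expansion
`∑ i, f i • σ i` of the section, so the passage between the two sides translates expansions
(`AffineMetric.hasCovDerivAlong_of_hat` and `AffineMetric.hasCovDerivAlong_hat`): the anchor takes an
expansion of `a` to one of `α'`, and an expansion of `α'` with the term `λ ξ` added is one of
`bar α' + λ ξ`.

The connections are defined by choice from the Koszul formula, so their existence has to be proved.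
For `∇` the Koszul expression is tensorial in its two outer arguments, hence a bilinear form on the
tangent space, and nondegeneracy of the metric represents it by a vector
(`AffineMetric.metric_nabla`). For `∇̂` the closed form itself satisfies the Koszul formula.
-/

/-! ### Uniqueness of the Levi-Civita connection -/

section Koszul

variable {E : Type*} [NormedAddCommGroup E] [NormedSpace ℝ E]
  {M : Type*} [TopologicalSpace M] [ChartedSpace E M] {V : M → Type*}

/-- A vector satisfying the Koszul formula is the value of the Levi-Civita connection, as soon as
the fibre metric is nondegenerate and every vector extends to a smooth section. -/
theorem leviCivita_eq_of_koszul [∀ p, Zero (V p)] {smoothAt : (Π p, V p) → M → Prop}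
    {ρ : ∀ p, V p → TangentSpace 𝓘(ℝ, E) p}
    {br : (Π p, V p) → (Π p, V p) → Π p, V p} {g : ∀ p, V p → V p → ℝ}
    {W : Π p, V p} {p : M} {u w : V p}
    (hext : ∀ v : V p, ∃ X : Π q, V q, smoothAt X p ∧ X p = v)
    (hg : ∀ x y : V p, (∀ z, g p x z = g p y z) → x = y)
    (hw : ∀ U Z : Π q, V q, smoothAt U p → smoothAt Z p → U p = u →
      2 * g p w (Z p) = koszul ρ br g U W Z p) :
    leviCivita smoothAt ρ br g W p u = w := by
  have key := Classical.epsilon_spec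
    (p := fun w : V p => ∀ U Z : Π q, V q, smoothAt U p → smoothAt Z p → U p = u →
      2 * g p w (Z p) = koszul ρ br g U W Z p) ⟨w, hw⟩
  refine hg _ _ fun z => ?_
  obtain ⟨U, hU, hUp⟩ := hext u
  obtain ⟨Z, hZ, rfl⟩ := hext z
  have h := (key U Z hU hZ hUp).trans (hw U Z hU hZ hUp).symm
  exact mul_left_cancel₀ two_ne_zero h

theorem dirDeriv_add {f g : M → ℝ} {p : M} (hf : MDifferentiableAt 𝓘(ℝ, E) 𝓘(ℝ, ℝ) f p)
    (hg : MDifferentiableAt 𝓘(ℝ, E) 𝓘(ℝ, ℝ) g p) (v : TangentSpace 𝓘(ℝ, E) p) :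
    dirDeriv (fun q => f q + g q) p v = dirDeriv f p v + dirDeriv g p v := by
  simp [dirDeriv, mvfderiv_fun_add hf hg]

theorem dirDeriv_mul {f g : M → ℝ} {p : M} (hf : MDifferentiableAt 𝓘(ℝ, E) 𝓘(ℝ, ℝ) f p)
    (hg : MDifferentiableAt 𝓘(ℝ, E) 𝓘(ℝ, ℝ) g p) (v : TangentSpace 𝓘(ℝ, E) p) :
    dirDeriv (fun q => f q * g q) p v = f p * dirDeriv g p v + g p * dirDeriv f p v := by
  simp [dirDeriv, mvfderiv_fun_mul hf hg]

theorem dirDeriv_const (c : ℝ) (p : M) (v : TangentSpace 𝓘(ℝ, E) p) :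
    dirDeriv (fun _ => c) p v = 0 := by
  simp [dirDeriv, mvfderiv_const]

theorem dirDeriv_vec_add (f : M → ℝ) (p : M) (v w : TangentSpace 𝓘(ℝ, E) p) :
    dirDeriv f p (v + w) = dirDeriv f p v + dirDeriv f p w :=
  map_add (mvfderiv 𝓘(ℝ, E) f p) v w

theorem dirDeriv_vec_smul (f : M → ℝ) (p : M) (c : ℝ) (v : TangentSpace 𝓘(ℝ, E) p) :
    dirDeriv f p (c • v) = c * dirDeriv f p v :=
  map_smul (mvfderiv 𝓘(ℝ, E) f p) c v

theorem SmoothFunAt.mdifferentiableAt {h : M → ℝ} {p : M} (hh : SmoothFunAt E h p) :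
    MDifferentiableAt 𝓘(ℝ, E) 𝓘(ℝ, ℝ) h p :=
  ContMDiffAt.mdifferentiableAt hh (by simp)

theorem mdifferentiableAt_sum {ι : Type*} (s : Finset ι) {f : ι → M → ℝ} {p : M}
    (hf : ∀ i ∈ s, MDifferentiableAt 𝓘(ℝ, E) 𝓘(ℝ, ℝ) (f i) p) :
    MDifferentiableAt 𝓘(ℝ, E) 𝓘(ℝ, ℝ) (fun q => ∑ i ∈ s, f i q) p := by
  classical
  induction s using Finset.induction_on with
  | empty => simpa using mdifferentiableAt_const
  | insert a s ha ih =>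
    simp only [Finset.sum_insert ha]
    exact (hf a (Finset.mem_insert_self a s)).add
      (ih fun i hi => hf i (Finset.mem_insert_of_mem hi))

end Koszul

/-! ### The semi-Riemannian metric of an affine metric -/

namespace AffineMetric

variable {E : Type*} [NormedAddCommGroup E] [NormedSpace ℝ E]
  {M : Type*} [TopologicalSpace M] [ChartedSpace E M]
  [IsManifold 𝓘(ℝ, E) ∞ M] (S : AffineMetric E M)

theorem metric_add_left (p : M) (x y z : TangentSpace 𝓘(ℝ, E) p) :
    S.metric p (x + y) z = S.metric p x z + S.metric p y z :=
  LinearMap.map_add₂ (bilinearPart (S.fiber p).toAffine) x y z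

theorem metric_smul_left (p : M) (c : ℝ) (x z : TangentSpace 𝓘(ℝ, E) p) :
    S.metric p (c • x) z = c * S.metric p x z :=
  LinearMap.map_smul₂ (bilinearPart (S.fiber p).toAffine) c x z

theorem metric_eq (p : M) (x y : TangentSpace 𝓘(ℝ, E) p) :
    S.metric p x y = (S.fiber p).toAffine x y - (S.fiber p).toAffine x 0
      - (S.fiber p).toAffine 0 y + (S.fiber p).toAffine 0 0 := by
  have h₁ := congrFun (AffineMap.decomp ((S.fiber p).toAffine x)) y
  have h₂ := congrFun (AffineMap.decomp ((S.fiber p).toAffine 0)) y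
  have h₃ : ((S.fiber p).toAffine.linear x).linear y =
      ((S.fiber p).toAffine x).linear y - ((S.fiber p).toAffine 0).linear y := by
    have := congrFun (AffineMap.decomp (S.fiber p).toAffine) x
    simp only [Pi.add_apply] at this
    simp [this]
  simp only [Pi.add_apply] at h₁ h₂
  change ((S.fiber p).toAffine.linear x).linear y = _
  rw [h₃, h₁, h₂]
  ring

theorem metric_symm (p : M) (x y : TangentSpace 𝓘(ℝ, E) p) :
    S.metric p x y = S.metric p y x := by
  rw [metric_eq, metric_eq, (S.fiber p).symm x y, (S.fiber p).symm x 0, (S.fiber p).symm y 0]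
  ring

theorem metric_add_right (p : M) (x y z : TangentSpace 𝓘(ℝ, E) p) :
    S.metric p x (y + z) = S.metric p x y + S.metric p x z := by
  simp only [S.metric_symm p x, metric_add_left]

theorem metric_smul_right (p : M) (c : ℝ) (x z : TangentSpace 𝓘(ℝ, E) p) :
    S.metric p x (c • z) = c * S.metric p x z := by
  simp only [S.metric_symm p x, metric_smul_left]

theorem metric_zero_left (p : M) (x : TangentSpace 𝓘(ℝ, E) p) : S.metric p 0 x = 0 := by
  simpa using S.metric_smul_left p 0 0 x

theorem metric_zero_right (p : M) (x : TangentSpace 𝓘(ℝ, E) p) : S.metric p x 0 = 0 := by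
  rw [metric_symm, metric_zero_left]

theorem metric_neg_left (p : M) (x y : TangentSpace 𝓘(ℝ, E) p) :
    S.metric p (-x) y = -S.metric p x y := by
  simpa using S.metric_smul_left p (-1) x y

theorem metric_sub_left (p : M) (x y z : TangentSpace 𝓘(ℝ, E) p) :
    S.metric p (x - y) z = S.metric p x z - S.metric p y z := by
  rw [sub_eq_add_neg, metric_add_left, metric_neg_left, sub_eq_add_neg]

/-- Nondegeneracy: a vector is determined by its products. -/
theorem eq_of_metric_eq {p : M} {x y : TangentSpace 𝓘(ℝ, E) p}
    (h : ∀ z, S.metric p x z = S.metric p y z) : x = y := by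
  have h' := (S.fiber p).nondegenerate.1 (x - y) fun z => by
    change S.metric p (x - y) z = 0
    rw [metric_sub_left, h, sub_self]
  exact sub_eq_zero.mp h'

/-- Nondegeneracy: every linear form is represented by a vector. -/
theorem exists_metric_eq [FiniteDimensional ℝ E] {p : M} (l : TangentSpace 𝓘(ℝ, E) p →ₗ[ℝ] ℝ) :
    ∃ x, ∀ z, S.metric p x z = l z :=
  ⟨(LinearMap.BilinForm.toDual _ (S.fiber p).nondegenerate).symm l, fun z =>
    LinearMap.BilinForm.apply_toDual_symm_apply (hB := (S.fiber p).nondegenerate) l z⟩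

theorem smoothFieldAt_zero (p : M) :
    SmoothFieldAt (E := E) (fun q : M => (0 : TangentSpace 𝓘(ℝ, E) q)) p :=
  (contMDiff_zeroSection ℝ (TangentSpace 𝓘(ℝ, E) : M → Type _)).contMDiffAt

/-- Every tangent vector is the value of a vector field that is smooth at its base point. -/
theorem exists_smoothFieldAt {p : M} (v : TangentSpace 𝓘(ℝ, E) p) :
    ∃ X : Π q : M, TangentSpace 𝓘(ℝ, E) q, SmoothFieldAt X p ∧ X p = v :=
  ⟨FiberBundle.extend E v, FiberBundle.contMDiffAt_extend .., by simp⟩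

theorem _root_.SmoothFieldAt.mdifferentiableAt {X : Π q : M, TangentSpace 𝓘(ℝ, E) q} {p : M}
    (hX : SmoothFieldAt X p) :
    MDifferentiableAt 𝓘(ℝ, E) 𝓘(ℝ, E).tangent
      (fun q => (⟨q, X q⟩ : TangentBundle 𝓘(ℝ, E) M)) p :=
  ContMDiffAt.mdifferentiableAt hX (by simp)

theorem smoothFunAt_metric {X Y : Π q : M, TangentSpace 𝓘(ℝ, E) q} {p : M}
    (hX : SmoothFieldAt X p) (hY : SmoothFieldAt Y p) :
    SmoothFunAt E (fun q => S.metric q (X q) (Y q)) p := by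
  have h0 := smoothFieldAt_zero (E := E) p
  simp only [metric_eq]
  exact ContMDiffAt.add (ContMDiffAt.sub (ContMDiffAt.sub (S.smooth _ _ p hX hY)
    (S.smooth _ _ p hX h0)) (S.smooth _ _ p h0 hY)) (S.smooth _ _ p h0 h0)

theorem metric_sum_smul {ι κ : Type*} [Fintype ι] [Fintype κ] (p : M) (c : ι → ℝ) (d : κ → ℝ)
    (x : ι → TangentSpace 𝓘(ℝ, E) p) (y : κ → TangentSpace 𝓘(ℝ, E) p) :
    S.metric p (∑ i, c i • x i) (∑ j, d j • y j) =
      ∑ i, ∑ j, c i * (d j * S.metric p (x i) (y j)) := by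
  change bilinearPart (S.fiber p).toAffine _ _ = _
  simp only [map_sum, LinearMap.sum_apply, map_smul, LinearMap.smul_apply, smul_eq_mul,
    Finset.mul_sum]
  rw [Finset.sum_comm]
  exact Finset.sum_congr rfl fun i _ => Finset.sum_congr rfl fun j _ => mul_left_comm _ _ _

/-- The metric of two differentiable vector fields is differentiable. An affine metric is tested
on smooth fields only, so the fields are expanded in a smooth local frame. -/
theorem mdifferentiableAt_metric [FiniteDimensional ℝ E]
    {X Y : Π q : M, TangentSpace 𝓘(ℝ, E) q} {p : M}
    (hX : MDifferentiableAt 𝓘(ℝ, E) 𝓘(ℝ, E).tangent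
      (fun q => (⟨q, X q⟩ : TangentBundle 𝓘(ℝ, E) M)) p)
    (hY : MDifferentiableAt 𝓘(ℝ, E) 𝓘(ℝ, E).tangent
      (fun q => (⟨q, Y q⟩ : TangentBundle 𝓘(ℝ, E) M)) p) :
    MDifferentiableAt 𝓘(ℝ, E) 𝓘(ℝ, ℝ) (fun q => S.metric q (X q) (Y q)) p := by
  have : IsManifold 𝓘(ℝ, E) (1 + 1) M := IsManifold.of_le (n := ∞) (by norm_cast)
  let t := trivializationAt E (TangentSpace 𝓘(ℝ, E)) p
  have hp : p ∈ t.baseSet := FiberBundle.mem_baseSet_trivializationAt E _ p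
  let b := Module.finBasis ℝ E
  have hs (i) : SmoothFieldAt (t.localFrame b i) p :=
    contMDiffAt_localFrame_of_mem ∞ _ b i hp
  have hc {σ : Π q : M, TangentSpace 𝓘(ℝ, E) q} (hσ : MDifferentiableAt 𝓘(ℝ, E) 𝓘(ℝ, E).tangent
      (fun q => (⟨q, σ q⟩ : TangentBundle 𝓘(ℝ, E) M)) p) (i) :
      MDifferentiableAt 𝓘(ℝ, E) 𝓘(ℝ, ℝ)
        (fun q => t.localFrameCoeff 𝓘(ℝ, E) b i q (σ q)) p :=
    mdifferentiableAt_localFrameCoeff b hp hσ i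
  have hsum : MDifferentiableAt 𝓘(ℝ, E) 𝓘(ℝ, ℝ) (fun q => ∑ i, ∑ j,
      t.localFrameCoeff 𝓘(ℝ, E) b i q (X q) * (t.localFrameCoeff 𝓘(ℝ, E) b j q (Y q) *
        S.metric q (t.localFrame b i q) (t.localFrame b j q))) p := by
    refine mdifferentiableAt_sum _ fun i _ => mdifferentiableAt_sum _ fun j _ => ?_
    exact (hc hX i).mul ((hc hY j).mul (S.smoothFunAt_metric (hs i) (hs j)).mdifferentiableAt)
  refine hsum.congr_of_eventuallyEq ?_
  filter_upwards [t.eventually_eq_localFrame_sum_coeff_smul (I := 𝓘(ℝ, E)) (s := X) b hp,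
    t.eventually_eq_localFrame_sum_coeff_smul (I := 𝓘(ℝ, E)) (s := Y) b hp] with q h₁ h₂
  conv_lhs => rw [h₁, h₂]
  exact S.metric_sum_smul q _ _ _ _

end AffineMetric

/-! ### The Levi-Civita connection of the metric and the tensor `F` -/

namespace AffineMetric

variable {E : Type*} [NormedAddCommGroup E] [NormedSpace ℝ E] [FiniteDimensional ℝ E]
  {M : Type*} [TopologicalSpace M] [ChartedSpace E M]
  [IsManifold 𝓘(ℝ, E) ∞ M] (S : AffineMetric E M)

omit [FiniteDimensional ℝ E] in
theorem isManifold_minSmoothness_three : IsManifold 𝓘(ℝ, E) (minSmoothness ℝ 3) M :=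
  IsManifold.of_le (n := ∞) (by
    rw [minSmoothness_of_isRCLikeNormedField]
    exact WithTop.coe_le_coe.mpr (le_top : (3 : ℕ∞) ≤ ⊤))

section Tensorial

variable {U W Z : Π q : M, TangentSpace 𝓘(ℝ, E) q} {p : M}

/-- The derivative terms of a factor `f` in `Z` cancel against the Leibniz terms of the brackets. -/
theorem tensorialAt_koszul_right
    (hU : MDifferentiableAt 𝓘(ℝ, E) 𝓘(ℝ, E).tangent
      (fun q => (⟨q, U q⟩ : TangentBundle 𝓘(ℝ, E) M)) p)
    (hW : MDifferentiableAt 𝓘(ℝ, E) 𝓘(ℝ, E).tangent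
      (fun q => (⟨q, W q⟩ : TangentBundle 𝓘(ℝ, E) M)) p) :
    TensorialAt 𝓘(ℝ, E) E (fun Z => koszul (fun _ v => v) (VectorField.mlieBracket 𝓘(ℝ, E))
      S.metric U W Z p) p := by
  have : IsManifold 𝓘(ℝ, E) (minSmoothness ℝ 3) M := isManifold_minSmoothness_three
  have : CompleteSpace E := FiniteDimensional.complete ℝ E
  constructor
  · intro f Z hf hZ
    have h₁ := dirDeriv_mul hf (S.mdifferentiableAt_metric hW hZ)
    have h₂ := dirDeriv_mul hf (S.mdifferentiableAt_metric hZ hU)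
    simp only [koszul, Pi.smul_apply', metric_smul_left, metric_smul_right, h₁, h₂,
      VectorField.mlieBracket_smul_right hf hZ, VectorField.mlieBracket_smul_left hf hZ,
      metric_add_left, smul_eq_mul, dirDeriv_vec_smul, S.metric_symm p (Z p) (U p),
      S.metric_symm p (Z p) (W p)]
    simp only [dirDeriv]
    ring
  · intro Z Z' hZ hZ'
    have h₁ := dirDeriv_add (S.mdifferentiableAt_metric hW hZ) (S.mdifferentiableAt_metric hW hZ')
    have h₂ := dirDeriv_add (S.mdifferentiableAt_metric hZ hU) (S.mdifferentiableAt_metric hZ' hU)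
    simp only [koszul, Pi.add_apply, metric_add_left, metric_add_right, h₁, h₂,
      VectorField.mlieBracket_add_right hZ hZ', VectorField.mlieBracket_add_left hZ hZ',
      dirDeriv_vec_add]
    ring

/-- As for the last argument: the derivatives of a factor `f` in `U` cancel. -/
theorem tensorialAt_koszul_left
    (hW : MDifferentiableAt 𝓘(ℝ, E) 𝓘(ℝ, E).tangent
      (fun q => (⟨q, W q⟩ : TangentBundle 𝓘(ℝ, E) M)) p)
    (hZ : MDifferentiableAt 𝓘(ℝ, E) 𝓘(ℝ, E).tangent
      (fun q => (⟨q, Z q⟩ : TangentBundle 𝓘(ℝ, E) M)) p) :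
    TensorialAt 𝓘(ℝ, E) E (fun U => koszul (fun _ v => v) (VectorField.mlieBracket 𝓘(ℝ, E))
      S.metric U W Z p) p := by
  have : IsManifold 𝓘(ℝ, E) (minSmoothness ℝ 3) M := isManifold_minSmoothness_three
  have : CompleteSpace E := FiniteDimensional.complete ℝ E
  constructor
  · intro f U hf hU
    have h₁ := dirDeriv_mul hf (S.mdifferentiableAt_metric hU hW)
    have h₂ := dirDeriv_mul hf (S.mdifferentiableAt_metric hZ hU)
    simp only [koszul, Pi.smul_apply', metric_smul_left, metric_smul_right, h₁, h₂,
      VectorField.mlieBracket_smul_right hf hU, VectorField.mlieBracket_smul_left hf hU,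
      metric_add_left, smul_eq_mul, dirDeriv_vec_smul, S.metric_symm p (Z p) (U p)]
    simp only [dirDeriv]
    ring
  · intro U U' hU hU'
    have h₁ := dirDeriv_add (S.mdifferentiableAt_metric hU hW) (S.mdifferentiableAt_metric hU' hW)
    have h₂ := dirDeriv_add (S.mdifferentiableAt_metric hZ hU) (S.mdifferentiableAt_metric hZ hU')
    simp only [koszul, Pi.add_apply, metric_add_left, metric_add_right, h₁, h₂,
      VectorField.mlieBracket_add_right hU hU', VectorField.mlieBracket_add_left hU hU',
      dirDeriv_vec_add]
    ring

end Tensorial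

/-- The Koszul formula at `p`, as a bilinear form in the values of the two outer arguments: this is
where existence of the Levi-Civita connection comes from. -/
theorem exists_koszul_bilin {W : Π q : M, TangentSpace 𝓘(ℝ, E) q} {p : M}
    (hW : SmoothFieldAt W p) :
    ∃ K : TangentSpace 𝓘(ℝ, E) p →ₗ[ℝ] TangentSpace 𝓘(ℝ, E) p →ₗ[ℝ] ℝ,
      ∀ U Z : Π q : M, TangentSpace 𝓘(ℝ, E) q, SmoothFieldAt U p → SmoothFieldAt Z p →
        K (U p) (Z p) = koszul (fun _ v => v) (VectorField.mlieBracket 𝓘(ℝ, E))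
          S.metric U W Z p := by
  have : IsManifold 𝓘(ℝ, E) (1 + 1) M := IsManifold.of_le (n := ∞) (by norm_cast)
  have h₁ (Z) (hZ) := S.tensorialAt_koszul_left (Z := Z) hW.mdifferentiableAt hZ
  have h₂ (U) (hU) := S.tensorialAt_koszul_right (U := U) hU hW.mdifferentiableAt
  let K : TangentSpace 𝓘(ℝ, E) p →L[ℝ] TangentSpace 𝓘(ℝ, E) p →L[ℝ] ℝ :=
    TensorialAt.mkHom₂ _ p h₁ h₂
  refine ⟨LinearMap.mk₂ ℝ (fun u z => K u z) (by simp) (by simp) (by simp) (by simp), ?_⟩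
  intro U Z hU hZ
  exact TensorialAt.mkHom₂_apply h₁ h₂ hU.mdifferentiableAt hZ.mdifferentiableAt

/-- `∇ W` at `p` exists and satisfies the Koszul formula, here with the Koszul expression given as a
bilinear form in the values. -/
theorem exists_metric_nabla_eq {W : Π q : M, TangentSpace 𝓘(ℝ, E) q} {p : M}
    (hW : SmoothFieldAt W p) :
    ∃ K : TangentSpace 𝓘(ℝ, E) p →ₗ[ℝ] TangentSpace 𝓘(ℝ, E) p →ₗ[ℝ] ℝ,
      (∀ u z, 2 * S.metric p (S.nabla W p u) z = K u z) ∧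
      ∀ U Z : Π q : M, TangentSpace 𝓘(ℝ, E) q, SmoothFieldAt U p → SmoothFieldAt Z p →
        K (U p) (Z p) = koszul (fun _ v => v) (VectorField.mlieBracket 𝓘(ℝ, E))
          S.metric U W Z p := by
  obtain ⟨K, hK⟩ := S.exists_koszul_bilin hW
  refine ⟨K, fun u z => ?_, hK⟩
  obtain ⟨w, hw⟩ := S.exists_metric_eq ((1 / 2 : ℝ) • K u)
  have h : S.nabla W p u = w := by
    refine leviCivita_eq_of_koszul exists_smoothFieldAt (fun x y => S.eq_of_metric_eq) ?_
    rintro U Z hU hZ rfl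
    rw [hw, ← hK U Z hU hZ]
    simp
  rw [h, hw]
  simp

/-- The Koszul formula for `∇`. -/
theorem metric_nabla {U W Z : Π q : M, TangentSpace 𝓘(ℝ, E) q} {p : M}
    (hU : SmoothFieldAt U p) (hW : SmoothFieldAt W p) (hZ : SmoothFieldAt Z p) :
    2 * S.metric p (S.nabla W p (U p)) (Z p) =
      koszul (fun _ v => v) (VectorField.mlieBracket 𝓘(ℝ, E)) S.metric U W Z p := by
  obtain ⟨K, hK, hK'⟩ := S.exists_metric_nabla_eq hW
  rw [hK, hK' U Z hU hZ]

/-- `∇ W` at `p`, as a linear map. -/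
theorem exists_linearMap_nabla {W : Π q : M, TangentSpace 𝓘(ℝ, E) q} {p : M}
    (hW : SmoothFieldAt W p) :
    ∃ L : TangentSpace 𝓘(ℝ, E) p →ₗ[ℝ] TangentSpace 𝓘(ℝ, E) p, ∀ v, S.nabla W p v = L v := by
  obtain ⟨K, hK, -⟩ := S.exists_metric_nabla_eq hW
  refine ⟨⟨⟨S.nabla W p, fun u v => S.eq_of_metric_eq fun z => ?_⟩,
    fun c u => S.eq_of_metric_eq fun z => ?_⟩, fun v => rfl⟩
  · have h₁ := hK (u + v) z
    rw [map_add, LinearMap.add_apply, ← hK, ← hK] at h₁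
    rw [metric_add_left]
    linarith
  · have h₁ := hK (c • u) z
    rw [map_smul, LinearMap.smul_apply, ← hK, smul_eq_mul] at h₁
    rw [RingHom.id_apply, metric_smul_left]
    linarith

omit [FiniteDimensional ℝ E] in
theorem nabla_zero (p : M) (u : TangentSpace 𝓘(ℝ, E) p) :
    S.nabla (fun q => (0 : TangentSpace 𝓘(ℝ, E) q)) p u = 0 := by
  refine leviCivita_eq_of_koszul exists_smoothFieldAt (fun x y => S.eq_of_metric_eq) ?_
  intro U Z _ _ _
  have h₁ : VectorField.mlieBracket 𝓘(ℝ, E) U (fun _ => 0) p = 0 :=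
    congrFun VectorField.mlieBracket_zero_right p
  have h₂ : VectorField.mlieBracket 𝓘(ℝ, E) (fun _ => 0) Z p = 0 :=
    congrFun VectorField.mlieBracket_zero_left p
  have h₃ := dirDeriv_vec_smul (E := E) (fun q => S.metric q (Z q) (U q)) p 0 0
  simp only [smul_zero, zero_mul] at h₃
  simp [koszul, h₁, h₂, h₃, metric_zero_left, metric_zero_right, dirDeriv_const]

section AntisymmetricPart

variable {A : Π q : M, TangentSpace 𝓘(ℝ, E) q} {p : M}

/-- The vector `F(v)` that defines `F` exists, because `∇ A` is linear. -/
theorem metric_F (hA : SmoothFieldAt A p) (v w : TangentSpace 𝓘(ℝ, E) p) :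
    S.metric p (S.F A p v) w =
      (1 / 2) * (S.metric p (S.nabla A p v) w - S.metric p v (S.nabla A p w)) := by
  obtain ⟨L, hL⟩ := S.exists_linearMap_nabla hA
  let B := bilinearPart (S.fiber p).toAffine
  obtain ⟨u, hu⟩ := S.exists_metric_eq ((1 / 2 : ℝ) • (B (L v) - (B v).comp L))
  exact Classical.epsilon_spec (p := fun u => ∀ w : TangentSpace 𝓘(ℝ, E) p,
    S.metric p u w = (1 / 2) * (S.metric p (S.nabla A p v) w - S.metric p v (S.nabla A p w)))
    ⟨u, fun w => by rw [hu, hL, hL]; rfl⟩ w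

theorem metric_F_swap (hA : SmoothFieldAt A p) (v w : TangentSpace 𝓘(ℝ, E) p) :
    S.metric p (S.F A p v) w = -S.metric p (S.F A p w) v := by
  rw [S.metric_F hA, S.metric_F hA, S.metric_symm p v, S.metric_symm p w]
  ring

theorem metric_F_self (hA : SmoothFieldAt A p) (v : TangentSpace 𝓘(ℝ, E) p) :
    S.metric p (S.F A p v) v = 0 := by
  linarith [S.metric_F_swap hA v v]

/-- `F` at `p`, as a linear map. -/
theorem exists_linearMap_F (hA : SmoothFieldAt A p) :
    ∃ L : TangentSpace 𝓘(ℝ, E) p →ₗ[ℝ] TangentSpace 𝓘(ℝ, E) p, ∀ v, S.F A p v = L v := by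
  refine ⟨⟨⟨S.F A p, fun u v => S.eq_of_metric_eq fun z => ?_⟩,
    fun c u => S.eq_of_metric_eq fun z => ?_⟩, fun v => rfl⟩
  · rw [metric_add_left, S.metric_F_swap hA, S.metric_F_swap hA u, S.metric_F_swap hA v,
      metric_add_right]
    ring
  · rw [RingHom.id_apply, metric_smul_left, S.metric_F_swap hA, S.metric_F_swap hA u,
      metric_smul_right]
    ring

end AntisymmetricPart

end AffineMetric

noncomputable section

/-! ### The connection of the algebroid of affine functions -/

namespace AffineMetric

variable {E : Type*} [NormedAddCommGroup E] [NormedSpace ℝ E] [FiniteDimensional ℝ E]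
  {M : Type*} [TopologicalSpace M] [ChartedSpace E M]
  [IsManifold 𝓘(ℝ, E) ∞ M] (S : AffineMetric E M)

/-- The anchor `rho` at `p`, as a linear map. -/
def rhoLin (p : M) : HatTangent E p →ₗ[ℝ] TangentSpace 𝓘(ℝ, E) p where
  toFun := S.rho p
  map_add' φ ψ := by simp [rho, AffineInnerProduct.rho]
  map_smul' c φ := by simp [rho, AffineInnerProduct.rho]

/-- The `ξ`-component at `p`, as a linear map. -/
def xiCoordLin (p : M) : HatTangent E p →ₗ[ℝ] ℝ where
  toFun := S.xiCoord p
  map_add' φ ψ := by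
    have h : (S.fiber p).rho (φ + ψ) = (S.fiber p).rho φ + (S.fiber p).rho ψ :=
      (S.rhoLin p).map_add φ ψ
    simp [xiCoord, AffineInnerProduct.xiCoord, h]
    ring
  map_smul' c φ := by
    have h : (S.fiber p).rho (c • φ) = c • (S.fiber p).rho φ := (S.rhoLin p).map_smul c φ
    simp [xiCoord, AffineInnerProduct.xiCoord, h]
    ring

@[simp]
theorem rhoLin_apply (p : M) (φ : HatTangent E p) : S.rhoLin p φ = S.rho p φ := rfl

@[simp]
theorem xiCoordLin_apply (p : M) (φ : HatTangent E p) : S.xiCoordLin p φ = S.xiCoord p φ := rfl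

@[simp]
theorem rho_bar_add_smul_xi (p : M) (x : TangentSpace 𝓘(ℝ, E) p) (c : ℝ) :
    S.rho p (S.bar p x + c • xi p) = x :=
  (S.fiber p).rho_bar_add_smul_xi x c

@[simp]
theorem xiCoord_bar_add_smul_xi (p : M) (x : TangentSpace 𝓘(ℝ, E) p) (c : ℝ) :
    S.xiCoord p (S.bar p x + c • xi p) = c :=
  (S.fiber p).xiCoord_bar_add_smul_xi x c

theorem bar_rho_add_xiCoord (p : M) (φ : HatTangent E p) :
    S.bar p (S.rho p φ) + S.xiCoord p φ • xi p = φ :=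
  (S.fiber p).bar_rho_add_xiCoord φ

@[simp]
theorem rho_bar (p : M) (x : TangentSpace 𝓘(ℝ, E) p) : S.rho p (S.bar p x) = x := by
  simpa using S.rho_bar_add_smul_xi p x 0

@[simp]
theorem xiCoord_bar (p : M) (x : TangentSpace 𝓘(ℝ, E) p) : S.xiCoord p (S.bar p x) = 0 := by
  simpa using S.xiCoord_bar_add_smul_xi p x 0

@[simp]
theorem rho_xi (p : M) : S.rho p (xi p) = 0 := by
  simpa using S.rho_bar_add_smul_xi p 0 1

@[simp]
theorem xiCoord_xi (p : M) : S.xiCoord p (xi p) = 1 := by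
  simpa using S.xiCoord_bar_add_smul_xi p 0 1

theorem hat_ext {p : M} {φ ψ : HatTangent E p} (h₁ : S.rho p φ = S.rho p ψ)
    (h₂ : S.xiCoord p φ = S.xiCoord p ψ) : φ = ψ := by
  rw [← S.bar_rho_add_xiCoord p φ, ← S.bar_rho_add_xiCoord p ψ, h₁, h₂]

theorem hatMetric_eq (p : M) (φ ψ : HatTangent E p) :
    S.hatMetric p φ ψ = S.metric p (S.rho p φ) (S.rho p ψ) + S.xiCoord p φ * S.xiCoord p ψ := rfl

theorem eq_of_hatMetric_eq {p : M} {φ ψ : HatTangent E p}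
    (h : ∀ χ, S.hatMetric p φ χ = S.hatMetric p ψ χ) : φ = ψ := by
  refine S.hat_ext (S.eq_of_metric_eq fun z => ?_) ?_
  · simpa [hatMetric_eq] using h (S.bar p z)
  · simpa [hatMetric_eq, metric_zero_right] using h (xi p)

theorem hatSmoothAt_bar_add_smul_xi {X : Π q : M, TangentSpace 𝓘(ℝ, E) q} {p : M}
    (hX : SmoothFieldAt X p) (c : ℝ) :
    S.HatSmoothAt (fun q => S.bar q (X q) + c • xi q) p := by
  refine ⟨?_, ?_⟩
  · simpa using hX
  · simp only [xiCoord_bar_add_smul_xi]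
    exact contMDiffAt_const

theorem exists_hatSmoothAt {p : M} (φ : HatTangent E p) :
    ∃ σ : Π q : M, HatTangent E q, S.HatSmoothAt σ p ∧ σ p = φ := by
  obtain ⟨X, hX, hXp⟩ := exists_smoothFieldAt (S.rho p φ)
  exact ⟨_, S.hatSmoothAt_bar_add_smul_xi hX (S.xiCoord p φ), by
    rw [hXp, S.bar_rho_add_xiCoord]⟩

theorem dirDeriv_hatMetric {σ τ : Π q : M, HatTangent E q} {p : M} (hσ : S.HatSmoothAt σ p)
    (hτ : S.HatSmoothAt τ p) (v : TangentSpace 𝓘(ℝ, E) p) :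
    dirDeriv (fun q => S.hatMetric q (σ q) (τ q)) p v =
      dirDeriv (fun q => S.metric q (S.rho q (σ q)) (S.rho q (τ q))) p v +
        (S.xiCoord p (σ p) * dirDeriv (fun q => S.xiCoord q (τ q)) p v +
          S.xiCoord p (τ p) * dirDeriv (fun q => S.xiCoord q (σ q)) p v) := by
  have h₁ := hσ.2.mdifferentiableAt
  have h₂ := hτ.2.mdifferentiableAt
  have h₃ : MDifferentiableAt 𝓘(ℝ, E) 𝓘(ℝ, ℝ)
      (fun q => S.xiCoord q (σ q) * S.xiCoord q (τ q)) p := h₁.mul h₂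
  simp only [hatMetric_eq]
  rw [dirDeriv_add (S.smoothFunAt_metric hσ.1 hτ.1).mdifferentiableAt h₃,
    dirDeriv_mul h₁ h₂]

/-- The Levi-Civita connection of the algebroid in terms of `∇` and `F`:
`∇̂_{X̄ + fξ} (Ȳ + gξ) = bar (∇_X Y - f F(Y) - g F(X)) + (X(g) + <F(X),Y>) ξ`. -/
theorem hatNabla_eq {A : Π q : M, TangentSpace 𝓘(ℝ, E) q} {W : Π q : M, HatTangent E q} {p : M}
    (hA : SmoothFieldAt A p) (hW : S.HatSmoothAt W p) (u : HatTangent E p) :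
    S.hatNabla A W p u =
      S.bar p (S.nabla (fun q => S.rho q (W q)) p (S.rho p u)
        - S.xiCoord p u • S.F A p (S.rho p (W p)) - S.xiCoord p (W p) • S.F A p (S.rho p u))
      + (dirDeriv (fun q => S.xiCoord q (W q)) p (S.rho p u)
        + S.metric p (S.F A p (S.rho p u)) (S.rho p (W p))) • xi p := by
  refine leviCivita_eq_of_koszul S.exists_hatSmoothAt (fun φ ψ => S.eq_of_hatMetric_eq) ?_
  rintro U Z hU hZ rfl
  have key := S.metric_nabla hU.1 hW.1 hZ.1
  simp only [koszul] at key ⊢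
  rw [S.dirDeriv_hatMetric hW hZ, S.dirDeriv_hatMetric hZ hU, S.dirDeriv_hatMetric hU hW]
  simp only [hatMetric_eq, hatBracket, rho_bar_add_smul_xi, xiCoord_bar_add_smul_xi,
    metric_sub_left, metric_smul_left]
  have h := S.metric_F_swap hA (S.rho p (Z p)) (S.rho p (U p))
  linear_combination key - 2 * S.xiCoord p (W p) * h

/-- The anchor of the expression that defines the covariant derivative along a path, in the direction
of `u`. In the last two terms the correction by `F` depends on the section only through its value
`∑ i, c i • σ i p`, not on its expansion. -/
theorem rho_sum_hatNabla {A : Π q : M, TangentSpace 𝓘(ℝ, E) q} {p : M} (hA : SmoothFieldAt A p)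
    {n : ℕ} (d c : Fin n → ℝ) {σ : Fin n → Π q : M, HatTangent E q}
    (hσ : ∀ i, S.HatSmoothAt (σ i) p) (u : HatTangent E p) :
    S.rho p (∑ i, (d i • σ i p + c i • S.hatNabla A (σ i) p u)) =
      ∑ i, (d i • S.rho p (σ i p) + c i • S.nabla (fun q => S.rho q (σ i q)) p (S.rho p u))
        - S.xiCoord p u • S.F A p (S.rho p (∑ i, c i • σ i p))
        - S.xiCoord p (∑ i, c i • σ i p) • S.F A p (S.rho p u) := by
  obtain ⟨L, hL⟩ := S.exists_linearMap_F hA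
  simp only [← rhoLin_apply, ← xiCoordLin_apply, map_sum, map_add, map_smul, hL]
  simp only [rhoLin_apply, xiCoordLin_apply, S.hatNabla_eq hA (hσ _), rho_bar_add_smul_xi, hL,
    smul_sub, smul_eq_mul, Finset.smul_sum, Finset.sum_smul, ← Finset.sum_sub_distrib]
  refine Finset.sum_congr rfl fun i _ => ?_
  module

/-- The `ξ`-component of the expression that defines the covariant derivative along a path. -/
theorem xiCoord_sum_hatNabla {A : Π q : M, TangentSpace 𝓘(ℝ, E) q} {p : M}
    (hA : SmoothFieldAt A p)
    {n : ℕ} (d c : Fin n → ℝ) {σ : Fin n → Π q : M, HatTangent E q}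
    (hσ : ∀ i, S.HatSmoothAt (σ i) p) (u : HatTangent E p) :
    S.xiCoord p (∑ i, (d i • σ i p + c i • S.hatNabla A (σ i) p u)) =
      ∑ i, (d i * S.xiCoord p (σ i p)
          + c i * dirDeriv (fun q => S.xiCoord q (σ i q)) p (S.rho p u))
        + S.metric p (S.F A p (S.rho p u)) (S.rho p (∑ i, c i • σ i p)) := by
  have h (x : TangentSpace 𝓘(ℝ, E) p) : S.metric p x (S.rho p (∑ i, c i • σ i p)) =
      ∑ i, c i * S.metric p x (S.rho p (σ i p)) := by
    change (bilinearPart (S.fiber p).toAffine x) (S.rhoLin p _) = _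
    simp only [map_sum, map_smul]
    rfl
  rw [h, ← xiCoordLin_apply, map_sum, ← Finset.sum_add_distrib]
  refine Finset.sum_congr rfl fun i _ => ?_
  rw [map_add, map_smul, map_smul, xiCoordLin_apply, xiCoordLin_apply, S.hatNabla_eq hA (hσ i),
    xiCoord_bar_add_smul_xi, smul_eq_mul, smul_eq_mul]
  ring

end AffineMetric

/-! ### Paths -/

section Path

variable {E : Type*} [NormedAddCommGroup E] [NormedSpace ℝ E]
  {M : Type*} [TopologicalSpace M] [ChartedSpace E M]

theorem velocity_congr {J : Set ℝ} {α β : ℝ → M} (h : EqOn α β J) {t : ℝ} (ht : t ∈ J) :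
    (⟨α t, velocity J α t⟩ : TangentBundle 𝓘(ℝ, E) M) = ⟨β t, velocity J β t⟩ := by
  have hv : (velocity J α t : E) = velocity (E := E) J β t :=
    congrArg (fun L : ℝ →L[ℝ] E => L 1)
      (mfderivWithin_congr (I := 𝓘(ℝ, ℝ)) (I' := 𝓘(ℝ, E)) h (h ht))
  exact TotalSpace.ext (h ht) (heq_of_eq hv)

/-- The chain rule for a function along a path. -/
theorem hasDerivWithinAt_comp_path {J : Set ℝ} {γ : ℝ → M} {t : ℝ} {g : M → ℝ}
    (hg : MDifferentiableAt 𝓘(ℝ, E) 𝓘(ℝ, ℝ) g (γ t))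
    (hγ : MDifferentiableWithinAt 𝓘(ℝ, ℝ) 𝓘(ℝ, E) γ J t) :
    HasDerivWithinAt (fun r => g (γ r)) (dirDeriv g (γ t) (velocity (E := E) J γ t)) J t := by
  let L : ℝ →L[ℝ] ℝ :=
    (mfderiv 𝓘(ℝ, E) 𝓘(ℝ, ℝ) g (γ t)).comp (mfderivWithin 𝓘(ℝ, ℝ) 𝓘(ℝ, E) γ J t)
  have h : HasFDerivWithinAt (fun r => g (γ r)) L J t :=
    hasMFDerivWithinAt_iff_hasFDerivWithinAt.mp
      (hg.hasMFDerivAt.comp_hasMFDerivWithinAt t hγ.hasMFDerivWithinAt)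
  exact h.hasDerivWithinAt

theorem Set.OrdConnected.uniqueDiffOn {J : Set ℝ} (hJ : J.OrdConnected) (hJ' : J.Nontrivial) :
    UniqueDiffOn ℝ J := by
  obtain ⟨x, hx, y, hy, hxy⟩ := hJ'.exists_lt
  refine uniqueDiffOn_convex hJ.convex ⟨(x + y) / 2, ?_⟩
  exact interior_maximal (Ioo_subset_Icc_self.trans (hJ.out hx hy)) isOpen_Ioo
    ⟨by linarith, by linarith⟩

end Path

namespace AffineMetric

variable {E : Type*} [NormedAddCommGroup E] [NormedSpace ℝ E] [FiniteDimensional ℝ E]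
  {M : Type*} [TopologicalSpace M] [ChartedSpace E M]
  [IsManifold 𝓘(ℝ, E) ∞ M] (S : AffineMetric E M)

/-- `∇̂_a a = 0` at `t` depends on the path `a` on the interval only. -/
theorem hasCovDerivAlong_hat_congr {A : Π p : M, TangentSpace 𝓘(ℝ, E) p} {J : Set ℝ}
    {a b : ℝ → HatBundle E M} (hab : EqOn a b J) {t : ℝ} (ht : t ∈ J)
    (h : HasCovDerivAlong S.HatSmoothAt (S.hatNabla A) J (fun r => (b r).proj)
      (fun r => (b r).snd) (fun r => (b r).snd) t 0) :
    HasCovDerivAlong S.HatSmoothAt (S.hatNabla A) J (fun r => (a r).proj)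
      (fun r => (a r).snd) (fun r => (a r).snd) t 0 := by
  obtain ⟨n, f, σ, hf, hσ, hs, hw⟩ := h
  refine ⟨n, f, σ, hf, ?_, ?_, ?_⟩
  · change ∀ i, S.HatSmoothAt (σ i) (a t).proj
    rw [hab ht]
    exact hσ
  · filter_upwards [hs, self_mem_nhdsWithin] with r hr hrJ
    rw [hab hrJ]
    exact hr
  · change (0 : HatTangent E (a t).proj) = ∑ i, (derivWithin (f i) J t • σ i (a t).proj +
      f i t • S.hatNabla A (σ i) (a t).proj (a t).snd)
    rw [hab ht]
    exact hw

/-- If `∇̂_s s = 0` at `t` and the anchor of `s` is the velocity of the base path `γ`, then the two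
components of the equation are `∇_{γ'} γ' = 2 f F(γ')` and `f' = 0`, with `f` the `ξ`-component. -/
theorem hasCovDerivAlong_of_hat {A : Π p : M, TangentSpace 𝓘(ℝ, E) p}
    (hA : ∀ p, SmoothFieldAt A p) {J : Set ℝ} {γ : ℝ → M} {s : ∀ t, HatTangent E (γ t)} {t : ℝ}
    (ht : t ∈ J)
    (hγ : MDifferentiableWithinAt 𝓘(ℝ, ℝ) 𝓘(ℝ, E) γ J t)
    (hv : ∀ r ∈ J, S.rho (γ r) (s r) = velocity J γ r)
    (h : HasCovDerivAlong S.HatSmoothAt (S.hatNabla A) J γ s s t 0) :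
    HasCovDerivAlong SmoothFieldAt S.nabla J γ (velocity J γ) (velocity J γ) t
        ((2 * S.xiCoord (γ t) (s t)) • S.F A (γ t) (velocity J γ t)) ∧
      HasDerivWithinAt (fun r => S.xiCoord (γ r) (s r)) 0 J t := by
  obtain ⟨n, f, σ, hf, hσ, hs, hw⟩ := h
  have hst := hs.self_of_nhdsWithin ht
  have hrho := S.rho_sum_hatNabla (hA (γ t)) (fun i => derivWithin (f i) J t) (fun i => f i t)
    hσ (s t)
  have hxi := S.xiCoord_sum_hatNabla (hA (γ t)) (fun i => derivWithin (f i) J t)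
    (fun i => f i t) hσ (s t)
  rw [← hw, ← hst, hv t ht, ← rhoLin_apply, map_zero] at hrho
  rw [← hw, ← hst, hv t ht, S.metric_F_self (hA _), add_zero, ← xiCoordLin_apply, map_zero] at hxi
  refine ⟨⟨n, f, fun i q => S.rho q (σ i q), hf, fun i => (hσ i).1, ?_, ?_⟩, ?_⟩
  · filter_upwards [hs, self_mem_nhdsWithin] with r hr hrJ
    rw [← hv r hrJ, hr, ← rhoLin_apply, map_sum]
    simp
  · rw [sub_sub, ← two_smul ℝ, smul_smul] at hrho
    exact (sub_eq_zero.mp hrho.symm).symm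
  · have hd : HasDerivWithinAt (fun r => ∑ i, f i r * S.xiCoord (γ r) (σ i (γ r))) 0 J t := by
      rw [hxi]
      refine HasDerivWithinAt.fun_sum fun i _ => ?_
      exact ((hf i).differentiableWithinAt (by simp)).hasDerivWithinAt.mul
        (hasDerivWithinAt_comp_path (hσ i).2.mdifferentiableAt hγ)
    refine hd.congr_of_eventuallyEq ?_ ?_
    · filter_upwards [hs] with r hr
      rw [hr, ← xiCoordLin_apply, map_sum]
      simp
    · rw [hst, ← xiCoordLin_apply, map_sum]
      simp

/-- Conversely, `∇_{α'} α' = 2 λ F(α')` gives `∇̂_a a = 0` for `a = bar α' + λ ξ`. -/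
theorem hasCovDerivAlong_hat {A : Π p : M, TangentSpace 𝓘(ℝ, E) p}
    (hA : ∀ p, SmoothFieldAt A p) {J : Set ℝ} {α : ℝ → M} {lam : ℝ} {t : ℝ} (ht : t ∈ J)
    (h : HasCovDerivAlong SmoothFieldAt S.nabla J α (velocity J α) (velocity J α) t
      ((2 * lam) • S.F A (α t) (velocity J α t))) :
    HasCovDerivAlong S.HatSmoothAt (S.hatNabla A) J α
      (fun r => S.bar (α r) (velocity J α r) + lam • xi (α r))
      (fun r => S.bar (α r) (velocity J α r) + lam • xi (α r)) t 0 := by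
  obtain ⟨n, f, X, hf, hX, hs, hw⟩ := h
  -- The expansion of `bar α'` coming from that of `α'`, with the additional term `λ ξ` in front.
  let f' : Fin (n + 1) → ℝ → ℝ := Fin.cons (fun _ => lam) f
  let σ : Fin (n + 1) → Π q : M, HatTangent E q := Fin.cons xi fun i q => S.bar q (X i q)
  have hσ (i) : S.HatSmoothAt (σ i) (α t) := by
    refine Fin.cases ?_ (fun j => ?_) i
    · have h := S.hatSmoothAt_bar_add_smul_xi (smoothFieldAt_zero (α t)) 1
      change S.HatSmoothAt xi _
      simpa using h
    · have h := S.hatSmoothAt_bar_add_smul_xi (hX j) 0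
      change S.HatSmoothAt (fun q => S.bar q (X j q)) _
      simpa using h
  have hsum : ∀ᶠ r in 𝓝[J] t, S.bar (α r) (velocity J α r) + lam • xi (α r) =
      ∑ i, f' i r • σ i (α r) := by
    filter_upwards [hs] with r hr
    rw [hr, Fin.sum_univ_succ, map_sum, add_comm]
    simp [f', σ]
  have hst := hsum.self_of_nhdsWithin ht
  refine ⟨n + 1, f', σ, ?_, hσ, hsum, ?_⟩
  · intro i
    refine Fin.cases contDiffWithinAt_const (fun j => hf j) i
  · have hrho := S.rho_sum_hatNabla (hA (α t)) (fun i => derivWithin (f' i) J t)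
      (fun i => f' i t) hσ (S.bar (α t) (velocity J α t) + lam • xi (α t))
    have hxi := S.xiCoord_sum_hatNabla (hA (α t)) (fun i => derivWithin (f' i) J t)
      (fun i => f' i t) hσ (S.bar (α t) (velocity J α t) + lam • xi (α t))
    rw [← hst] at hrho hxi
    simp only [rho_bar_add_smul_xi, xiCoord_bar_add_smul_xi, S.metric_F_self (hA _),
      Fin.sum_univ_succ (n := n)] at hrho hxi
    refine S.hat_ext ?_ ?_
    · rw [← rhoLin_apply, map_zero, Fin.sum_univ_succ, hrho]
      simp only [f', σ, Fin.cons_zero, Fin.cons_succ, rho_xi, rho_bar, nabla_zero, smul_zero,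
        add_zero, zero_add]
      rw [← hw]
      module
    · rw [← xiCoordLin_apply, map_zero, Fin.sum_univ_succ, hxi]
      simp [f', σ, dirDeriv_const]

end AffineMetric

end

theorem proposition3p5
    {E : Type*} [NormedAddCommGroup E] [NormedSpace ℝ E] [FiniteDimensional ℝ E]
    {M : Type*} [TopologicalSpace M] [ChartedSpace E M] [IsManifold 𝓘(ℝ, E) ∞ M]
    [T2Space M] [SecondCountableTopology M]
    (S : AffineMetric E M)
    (A : Π p : M, TangentSpace 𝓘(ℝ, E) p) (hA : ∀ p, SmoothFieldAt A p)
    (hS : ∀ (p : M) (x y : TangentSpace 𝓘(ℝ, E) p),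
      S.aff p x y = 1 + S.metric p (x - A p) (y - A p))
    (J : Set ℝ) (hJ : J.OrdConnected) (hJ' : J.Nontrivial)
    (a : ℝ → HatBundle E M) (ha : S.IsHatPath J a) :
    S.IsGeodesic A J a ↔
      ∃ (α : ℝ → M) (lam : ℝ), ContMDiffOn 𝓘(ℝ, ℝ) 𝓘(ℝ, E) ∞ α J ∧
        (∀ t ∈ J, a t = ⟨α t, S.bar (α t) (velocity J α t) + lam • AffineMetric.xi (α t)⟩) ∧
        ∀ t ∈ J, HasCovDerivAlong SmoothFieldAt S.nabla J α (velocity J α) (velocity J α) t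
          ((2 * lam) • S.F A (α t) (velocity J α t)) := by
  have hJu := hJ.uniqueDiffOn hJ'
  constructor
  · rintro ⟨⟨α, hα, haα⟩, hcov⟩
    -- The base path of `a` agrees with `α` on `J`; outside `J` the two may differ.
    have hproj : EqOn (fun r => (a r).proj) α J := fun t ht => congrArg TotalSpace.proj (haα t ht)
    have hγ : ContMDiffOn 𝓘(ℝ, ℝ) 𝓘(ℝ, E) ∞ (fun r => (a r).proj) J := hα.congr hproj
    have hv : ∀ t ∈ J, S.rho (a t).proj (a t).snd = velocity J (fun r => (a r).proj) t :=
      fun t ht => TotalSpace.mk_injective _ ((haα t ht).trans (velocity_congr hproj ht).symm)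
    have key (t) (ht : t ∈ J) := S.hasCovDerivAlong_of_hat hA ht
      ((hγ t ht).mdifferentiableWithinAt (by simp)) hv (hcov t ht)
    obtain ⟨t₀, ht₀⟩ := hJ'.nonempty
    have hconst : ∀ t ∈ J, S.xiCoord (a t).proj (a t).snd = S.xiCoord (a t₀).proj (a t₀).snd :=
      fun t ht => hJ.convex.is_const_of_fderivWithin_eq_zero
        (fun r hr => (key r hr).2.differentiableWithinAt)
        (fun r hr => by
          simpa using (key r hr).2.hasFDerivWithinAt.fderivWithin (hJu r hr)) ht ht₀
    refine ⟨fun r => (a r).proj, S.xiCoord (a t₀).proj (a t₀).snd, hγ, fun t ht => ?_,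
      fun t ht => ?_⟩
    · refine TotalSpace.ext rfl (heq_of_eq ?_)
      simp only
      rw [← hv t ht, ← hconst t ht, S.bar_rho_add_xiCoord]
    · rw [← hconst t ht]
      exact (key t ht).1
  · rintro ⟨α, lam, hα, haα, hcov⟩
    refine ⟨⟨α, hα, fun t ht => ?_⟩, fun t ht => ?_⟩
    · rw [haα t ht, S.rho_bar_add_smul_xi]
    · exact S.hasCovDerivAlong_hat_congr haα ht (S.hasCovDerivAlong_hat hA ht (hcov t ht))
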